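/- Let $\mathbb{H}$ be the quaternions with the Euclidean norm, $\mathbb{S}=\{I\in\mathbb{H} : I^2=-1\}$, $\mathbb{C}_I=\mathbb{R}+\mathbb{R}I$ for $I\in\mathbb{S}$, and let $\mu$ be any Borel probability measure on $\mathbb{S}$. For $w\in\mathbb{S}$ put $S_w(q)=w^{-1}qw$ and $(R_wf)(q)=S_w^{-1}(f(S_w(q)))$. At a point $q\in\mathbb{C}_I\setminus\mathbb{R}$ put $\partial_*f=\frac12(\partial_1-I\partial_I)f$ and $\bar\partial_*f=\frac12(\partial_1+I\partial_I)f$, where $\partial_v$ is the derivative in the direction $v\in\mathbb{H}$; put $\Delta_*f=4\,\partial_*\bar\partial_*f$ and $$\Delta'f=\Delta_*\Big(\int_{\mathbb{S}}R_wf\,d\sigma(w)\Big),$$ where $\sigma$ is the rotation invariant probability measure (normalized surface measure) on $\mathbb{S}$. Let $\overline{\mathbb{B}_R}=\{q\in\mathbb{H}:|q|\le R\}$ and let $u\colon\overline{\mathbb{B}_R}\to\mathbb{R}$ be of class $C^2$ (up to the boundary) and rotationally invariant, i.e. invariant under all orthogonal transformations of the space of imaginary quaternions (extended to $\mathbb{H}$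 by the identity on $\mathbb{R}$). Assume that $\Delta'u=0$ at all non-real points of the open ball $\mathbb{B}_R$. Then, for every $a\in\mathbb{R}$ with $|a|<R$, $$u(a)=\frac{1}{2\pi}\int_{\mathbb{S}}\int_0^{2\pi}\frac{R^2-a^2}{|R\,e^{I\theta}-a|^2}\,u(R\,e^{I\theta})\,d\theta\,d\mu(I).$$ -/

import Mathlib

open scoped Quaternion
open MeasureTheory

namespace SliceQuat

noncomputable section

/-- The set `𝕊` of imaginary units of the quaternions, i.e. the solutions of `x ^ 2 = -1`. -/
abbrev ImUnit : Type := {x : ℍ[ℝ] // x ^ 2 = -1}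

instance instMeasurableSpaceImUnit : MeasurableSpace ImUnit := borel ImUnit

instance instBorelSpaceImUnit : BorelSpace ImUnit := ⟨rfl⟩

/-- The imaginary quaternion `x i + y j + z k`. -/
def imQuat (x y z : ℝ) : ℍ[ℝ] := ⟨0, x, y, z⟩

theorem imQuat_sq {x y z : ℝ} (h : x ^ 2 + y ^ 2 + z ^ 2 = 1) : imQuat x y z ^ 2 = -1 := by
  have h0 : (imQuat x y z).re = 0 := rfl
  have h1 : (imQuat x y z).imI = x := rfl
  have h2 : (imQuat x y z).imJ = y := rfl
  have h3 : (imQuat x y z).imK = z := rfl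
  rw [sq]
  ext
  · simp only [Quaternion.re_mul, h0, h1, h2, h3, Quaternion.re_neg, Quaternion.re_one]
    linarith
  · simp only [Quaternion.imI_mul, h0, h1, h2, h3, Quaternion.imI_neg, Quaternion.imI_one]
    ring
  · simp only [Quaternion.imJ_mul, h0, h1, h2, h3, Quaternion.imJ_neg, Quaternion.imJ_one]
    ring
  · simp only [Quaternion.imK_mul, h0, h1, h2, h3, Quaternion.imK_neg, Quaternion.imK_one]
    ring

/-- The identification of the unit sphere of `ℝ³` with the sphere `𝕊` of imaginary units,
`(v₀, v₁, v₂) ↦ v₀ i + v₁ j + v₂ k`. -/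
def sphereToImUnit (v : Metric.sphere (0 : EuclideanSpace ℝ (Fin 3)) 1) : ImUnit :=
  ⟨imQuat (v.1 0) (v.1 1) (v.1 2), imQuat_sq (by
    have hv : ‖v.1‖ = 1 := by simp
    have h2 := EuclideanSpace.norm_sq_eq v.1
    rw [hv, Fin.sum_univ_three] at h2
    simpa using h2.symm)⟩

theorem continuous_sphereToImUnit : Continuous sphereToImUnit := by
  refine Continuous.subtype_mk ?_ _
  have h : Continuous fun v : Metric.sphere (0 : EuclideanSpace ℝ (Fin 3)) 1 =>
      Quaternion.linearIsometryEquivTuple.symm (!₂[(0 : ℝ), v.1 0, v.1 1, v.1 2]) := by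
    refine Quaternion.linearIsometryEquivTuple.symm.continuous.comp ?_
    refine (PiLp.continuous_toLp 2 _).comp (continuous_pi fun i => ?_)
    fin_cases i <;> simp <;> fun_prop
  exact h

/-- The rotation invariant probability measure on `𝕊`: the normalized surface measure of the
unit sphere of the space of imaginary quaternions. -/
def invMeasure : Measure ImUnit :=
  ((volume : Measure (EuclideanSpace ℝ (Fin 3))).toSphere Set.univ)⁻¹ •
    ((volume : Measure (EuclideanSpace ℝ (Fin 3))).toSphere).map sphereToImUnit

instance instIsProbabilityMeasureInvMeasure : IsProbabilityMeasure invMeasure := by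
  constructor
  rw [invMeasure, Measure.smul_apply,
    Measure.map_apply continuous_sphereToImUnit.measurable MeasurableSet.univ, Set.preimage_univ,
    smul_eq_mul]
  refine ENNReal.inv_mul_cancel ?_ (measure_ne_top _ _)
  rw [Measure.toSphere_apply_univ]
  refine mul_ne_zero (by simp) ?_
  exact (Metric.measure_ball_pos _ _ one_pos).ne'

/-- The rotation `S_w : q ↦ w⁻¹ q w`. -/
def rot (w q : ℍ[ℝ]) : ℍ[ℝ] := w⁻¹ * q * w

/-- The operator `R_w`, with `(R_w f)(q) = S_w⁻¹ (f (S_w q))`, where `S_w⁻¹ = S_{w⁻¹}`. -/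
def rotAct (w : ImUnit) (f : ℍ[ℝ] → ℍ[ℝ]) (q : ℍ[ℝ]) : ℍ[ℝ] :=
  rot (w : ℍ[ℝ])⁻¹ (f (rot w q))

/-- The average `∫_𝕊 R_w f dμ(w)` with respect to the rotation invariant probability measure. -/
def rotAverage (f : ℍ[ℝ] → ℍ[ℝ]) (q : ℍ[ℝ]) : ℍ[ℝ] :=
  ∫ w : ImUnit, rotAct w f q ∂invMeasure

/-- For a non-real quaternion `q`, the imaginary unit `I = Im q / |Im q|`, for which
`q ∈ ℂ_I`. The only other choice is `-I`; the operators below do not depend on it. -/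
def axis (q : ℍ[ℝ]) : ℍ[ℝ] := ‖q.im‖⁻¹ • q.im

/-- `∂_* f = (∂₁ f - I ∂_I f) / 2` at non-real points `q ∈ ℂ_I`, with directional
derivatives. -/
def dStar (f : ℍ[ℝ] → ℍ[ℝ]) (q : ℍ[ℝ]) : ℍ[ℝ] :=
  (1 / 2 : ℝ) • (lineDeriv ℝ f q 1 - axis q * lineDeriv ℝ f q (axis q))

/-- `∂̄_* f = (∂₁ f + I ∂_I f) / 2` at non-real points `q ∈ ℂ_I`. -/
def dBarStar (f : ℍ[ℝ] → ℍ[ℝ]) (q : ℍ[ℝ]) : ℍ[ℝ] :=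
  (1 / 2 : ℝ) • (lineDeriv ℝ f q 1 + axis q * lineDeriv ℝ f q (axis q))

/-- The Laplacian `Δ_* f = 4 ∂_* ∂̄_* f` at non-real points. -/
def laplaceStar (f : ℍ[ℝ] → ℍ[ℝ]) (q : ℍ[ℝ]) : ℍ[ℝ] :=
  (4 : ℝ) • dStar (dBarStar f) q

/-- The operator `Δ' f = Δ_* (∫_𝕊 R_w f dμ(w))` at non-real points. -/
def laplacePrime (f : ℍ[ℝ] → ℍ[ℝ]) (q : ℍ[ℝ]) : ℍ[ℝ] :=
  laplaceStar (rotAverage f) q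

/-- A function on a set `Ω` of quaternions is rotationally invariant if it is invariant under all
orthogonal transformations of the space of imaginary quaternions, each extended to `ℍ` by the
identity on `ℝ` (these extensions are the linear isometries of `ℍ` that fix `1`). -/
def RotationallyInvariantOn {α : Type*} (f : ℍ[ℝ] → α) (Ω : Set ℍ[ℝ]) : Prop :=
  ∀ T : ℍ[ℝ] ≃ₗᵢ[ℝ] ℍ[ℝ], T 1 = 1 → ∀ q ∈ Ω, T q ∈ Ω → f (T q) = f q

end

end SliceQuat

open Topology Filter

namespace SliceQuat

noncomputable section

/-! Since `u` is real and rotationally invariant, averaging over rotations does nothing to it on the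
ball (`rotAverage_of_rotationallyInvariantOn`). On real `C²` functions `Δ_*` is the Laplacian of the
restriction to the plane `ℂ_I` (`laplaceStar_coe`, `laplacian_comp_planeCLM`). Hence `u` restricted
to each `ℂ_I` is harmonic in the disc off the real axis, and on it by continuity of the second
derivatives (`harmonicContOnCl_comp_planeCLM`). The classical Poisson formula makes the inner
integral `2π u(a)` for every `I`, so any probability measure `μ` gives the same average. -/

theorem norm_of_sq_eq_neg_one {x : ℍ[ℝ]} (h : x ^ 2 = -1) : ‖x‖ = 1 := by
  have h2 : ‖x‖ ^ 2 = 1 := by rw [← norm_pow, h, norm_neg, norm_one]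
  exact (pow_eq_one_iff_of_nonneg (norm_nonneg x) two_ne_zero).1 h2

theorem re_of_sq_eq_neg_one {x : ℍ[ℝ]} (h : x ^ 2 = -1) : x.re = 0 := by
  rw [← Quaternion.sq_eq_neg_normSq, h, Quaternion.normSq_eq_norm_mul_self,
    norm_of_sq_eq_neg_one h]
  simp

theorem im_of_sq_eq_neg_one {x : ℍ[ℝ]} (h : x ^ 2 = -1) : x.im = x := by
  have := Quaternion.re_add_im x
  rwa [re_of_sq_eq_neg_one h, Quaternion.coe_zero, zero_add] at this

theorem ne_zero_of_sq_eq_neg_one {x : ℍ[ℝ]} (h : x ^ 2 = -1) : x ≠ 0 := by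
  rw [← norm_pos_iff, norm_of_sq_eq_neg_one h]
  exact one_pos

theorem axis_im {q : ℍ[ℝ]} : (axis q).im = axis q := by
  simp [axis]

theorem axis_sq {q : ℍ[ℝ]} (hq : q.im ≠ 0) : axis q ^ 2 = -1 := by
  have h0 : ‖q.im‖ ≠ 0 := norm_ne_zero_iff.2 hq
  have h1 : (axis q).re = 0 := by simp [axis]
  rw [Quaternion.sq_eq_neg_normSq.2 h1, Quaternion.normSq_eq_norm_mul_self, axis, norm_smul,
    norm_inv, norm_norm, inv_mul_cancel₀ h0]
  simp

/-! ### Rotations -/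

/-- The rotation `q ↦ w⁻¹ q w` as a linear isometry. -/
def rotIsometry (w : ℍ[ℝ]) (hw : w ≠ 0) : ℍ[ℝ] ≃ₗᵢ[ℝ] ℍ[ℝ] where
  toFun := rot w
  invFun := rot w⁻¹
  map_add' x y := by simp [rot, mul_add, add_mul]
  map_smul' c x := by simp [rot]
  left_inv x := by simp [rot, mul_assoc, hw]
  right_inv x := by simp [rot, mul_assoc, hw]
  norm_map' x := by
    change ‖rot w x‖ = ‖x‖
    have : ‖w‖ ≠ 0 := norm_ne_zero_iff.2 hw
    rw [rot, norm_mul, norm_mul, norm_inv]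
    field_simp

theorem rot_coe {w : ℍ[ℝ]} (hw : w ≠ 0) (r : ℝ) : rot w (r : ℍ[ℝ]) = r := by
  rw [rot, mul_assoc, Quaternion.coe_commutes, ← mul_assoc, inv_mul_cancel₀ hw, one_mul]

/-- Invariance absorbs the inner rotation, and the outer one fixes the real value `u q`; the
integrand is therefore constant in `w`. -/
theorem rotAverage_of_rotationallyInvariantOn {R : ℝ} {u : ℍ[ℝ] → ℝ}
    (hrot : RotationallyInvariantOn u (Metric.closedBall 0 R)) {q : ℍ[ℝ]}
    (hq : q ∈ Metric.closedBall (0 : ℍ[ℝ]) R) :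
    rotAverage (fun p => (u p : ℍ[ℝ])) q = u q := by
  have h : ∀ w : ImUnit, rotAct w (fun p => (u p : ℍ[ℝ])) q = u q := fun w => by
    have hw := ne_zero_of_sq_eq_neg_one w.2
    rw [rotAct, rot_coe (inv_ne_zero hw)]
    congr 1
    refine hrot (rotIsometry w hw) ?_ q hq ?_
    · exact_mod_cast rot_coe hw 1
    · rw [mem_closedBall_zero_iff, LinearIsometryEquiv.norm_map]
      exact mem_closedBall_zero_iff.1 hq
  simp [rotAverage, h]

/-! ### The operator `Δ_*` on real functions -/

theorem lineDeriv_congr_of_eventuallyEq {E F : Type*} [NormedAddCommGroup E] [NormedSpace ℝ E]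
    [NormedAddCommGroup F] [NormedSpace ℝ F] {f g : E → F} {x : E} (h : f =ᶠ[𝓝 x] g) (v : E) :
    lineDeriv ℝ f x v = lineDeriv ℝ g x v := by
  have hc : Tendsto (fun t : ℝ => x + t • v) (𝓝 0) (𝓝 x) := by
    have : Continuous fun t : ℝ => x + t • v := by fun_prop
    simpa using this.tendsto 0
  exact EventuallyEq.deriv_eq (hc.eventually h)

theorem laplaceStar_congr {f g : ℍ[ℝ] → ℍ[ℝ]} {q : ℍ[ℝ]} (h : f =ᶠ[𝓝 q] g) :
    laplaceStar f q = laplaceStar g q := by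
  have hbar : dBarStar f =ᶠ[𝓝 q] dBarStar g := by
    filter_upwards [h.eventuallyEq_nhds] with p hp
    simp only [dBarStar, lineDeriv_congr_of_eventuallyEq hp]
  simp only [laplaceStar, dStar, lineDeriv_congr_of_eventuallyEq hbar]

theorem axis_eq_of_im {p q : ℍ[ℝ]} {c : ℝ} (hc : 0 < c) (h : p.im = c • q.im) :
    axis p = axis q := by
  rw [axis, axis, h, norm_smul, Real.norm_of_nonneg hc.le, smul_smul, mul_inv, mul_right_comm,
    inv_mul_cancel₀ hc.ne', one_mul]

theorem eventually_axis_add_smul_one (q : ℍ[ℝ]) :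
    ∀ᶠ t : ℝ in 𝓝 0, axis (q + t • (1 : ℍ[ℝ])) = axis q := by
  refine .of_forall fun t => axis_eq_of_im one_pos ?_
  simp

/-- The imaginary part is only rescaled by `1 + t / ‖q.im‖`, which stays positive for small `t`. -/
theorem eventually_axis_add_smul_axis (q : ℍ[ℝ]) :
    ∀ᶠ t : ℝ in 𝓝 0, axis (q + t • axis q) = axis q := by
  have hc : Continuous fun t : ℝ => 1 + t * ‖q.im‖⁻¹ := by fun_prop
  filter_upwards [hc.continuousAt.eventually (lt_mem_nhds (by simp : (0 : ℝ) < 1 + 0 * ‖q.im‖⁻¹))]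
    with t ht
  refine axis_eq_of_im ht ?_
  rw [Quaternion.im_add, Quaternion.im_smul, axis_im, axis, add_smul, one_smul, smul_smul]

theorem lineDeriv_coe {u : ℍ[ℝ] → ℝ} {p : ℍ[ℝ]} (h : DifferentiableAt ℝ u p) (v : ℍ[ℝ]) :
    lineDeriv ℝ (fun p => (u p : ℍ[ℝ])) p v = (fderiv ℝ u p v : ℝ) := by
  have h1 := h.hasFDerivAt.hasLineDerivAt v
  have h2 := (algebraMapCLM ℝ ℍ[ℝ]).hasFDerivAt.comp_hasDerivAt (0 : ℝ) h1
  exact h2.deriv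

/-- The hypothesis `hv` freezes the factor `I` in `∂̄_*` along the line, so only the derivatives of
`u` get differentiated. -/
theorem lineDeriv_dBarStar_coe {u : ℍ[ℝ] → ℝ} {q v : ℍ[ℝ]} (h : ContDiffAt ℝ 2 u q)
    (hv : ∀ᶠ t : ℝ in 𝓝 0, axis (q + t • v) = axis q) :
    lineDeriv ℝ (dBarStar fun p => (u p : ℍ[ℝ])) q v =
      (1 / 2 : ℝ) • (((fderiv ℝ (fderiv ℝ u) q v 1 : ℝ) : ℍ[ℝ]) +
        axis q * (fderiv ℝ (fderiv ℝ u) q v (axis q) : ℝ)) := by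
  have hc : Tendsto (fun t : ℝ => q + t • v) (𝓝 0) (𝓝 q) := by
    have : Continuous fun t : ℝ => q + t • v := by fun_prop
    simpa using this.tendsto 0
  have hd : ∀ᶠ p in 𝓝 q, DifferentiableAt ℝ u p := by
    filter_upwards [h.eventually (by simp)] with p hp
    exact hp.differentiableAt (by simp)
  have heq : (fun t : ℝ => dBarStar (fun p => (u p : ℍ[ℝ])) (q + t • v)) =ᶠ[𝓝 0] fun t =>
      (1 / 2 : ℝ) • (((fderiv ℝ u (q + t • v) 1 : ℝ) : ℍ[ℝ]) +
        axis q * (fderiv ℝ u (q + t • v) (axis q) : ℝ)) := by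
    filter_upwards [hv, hc.eventually hd] with t ht ht'
    rw [dBarStar, lineDeriv_coe ht', lineDeriv_coe ht', ht]
  have hD : DifferentiableAt ℝ (fderiv ℝ u) q :=
    (h.fderiv_right (m := 1) (by norm_num)).differentiableAt (by simp)
  have key : ∀ e : ℍ[ℝ], HasDerivAt (fun t : ℝ => ((fderiv ℝ u (q + t • v) e : ℝ) : ℍ[ℝ]))
      ((fderiv ℝ (fderiv ℝ u) q v e : ℝ) : ℍ[ℝ]) 0 := fun e => by
    have h1 := hD.hasFDerivAt.clm_apply (hasFDerivAt_const e q)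
    have h2 : HasDerivAt (fun t : ℝ => fderiv ℝ u (q + t • v) e)
        (fderiv ℝ (fderiv ℝ u) q v e) 0 := by
      simpa [HasLineDerivAt] using h1.hasLineDerivAt v
    exact (algebraMapCLM ℝ ℍ[ℝ]).hasFDerivAt.comp_hasDerivAt (0 : ℝ) h2
  exact heq.deriv_eq.trans (((key 1).add ((key (axis q)).const_mul (axis q))).const_smul (1 / 2 : ℝ)).deriv

/-- The mixed terms cancel by symmetry of the second derivative, and `I² = -1` makes the `I`-term
positive. -/
theorem laplaceStar_coe {u : ℍ[ℝ] → ℝ} {q : ℍ[ℝ]} (h : ContDiffAt ℝ 2 u q) (hq : q.im ≠ 0) :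
    laplaceStar (fun p => (u p : ℍ[ℝ])) q =
      ((fderiv ℝ (fderiv ℝ u) q 1 1 + fderiv ℝ (fderiv ℝ u) q (axis q) (axis q) : ℝ) : ℍ[ℝ]) := by
  have hsymm : fderiv ℝ (fderiv ℝ u) q 1 (axis q) = fderiv ℝ (fderiv ℝ u) q (axis q) 1 :=
    (h.isSymmSndFDerivAt (by simp)).eq 1 (axis q)
  have hJ : axis q * axis q = -1 := by rw [← sq, axis_sq hq]
  rw [laplaceStar, dStar, lineDeriv_dBarStar_coe h (eventually_axis_add_smul_one q),
    lineDeriv_dBarStar_coe h (eventually_axis_add_smul_axis q), hsymm, mul_smul_comm, mul_add,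
    ← mul_assoc, hJ, neg_one_mul, Quaternion.coe_add]
  module

/-! ### The complex planes `ℂ_I` -/

/-- The parametrization `x + y i ↦ x + y I` of the plane `ℂ_I`. -/
def planeCLM (I : ℍ[ℝ]) : ℂ →L[ℝ] ℍ[ℝ] :=
  Complex.reCLM.smulRight (1 : ℍ[ℝ]) + Complex.imCLM.smulRight I

theorem planeCLM_apply (I : ℍ[ℝ]) (z : ℂ) : planeCLM I z = z.re • (1 : ℍ[ℝ]) + z.im • I := rfl

theorem im_planeCLM {I : ℍ[ℝ]} (hI : I ^ 2 = -1) (z : ℂ) : (planeCLM I z).im = z.im • I := by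
  simp [planeCLM_apply, im_of_sq_eq_neg_one hI]

theorem norm_planeCLM {I : ℍ[ℝ]} (hI : I ^ 2 = -1) (z : ℂ) : ‖planeCLM I z‖ = ‖z‖ := by
  have h : ‖planeCLM I z‖ ^ 2 = ‖z‖ ^ 2 := by
    have h1 := norm_of_sq_eq_neg_one hI
    have h2 : inner ℝ (1 : ℍ[ℝ]) I = 0 := by
      simp [Quaternion.inner_def, re_of_sq_eq_neg_one hI]
    rw [planeCLM_apply, norm_add_sq_real, inner_smul_left, inner_smul_right, h2, norm_smul,
      norm_smul, h1, norm_one, Complex.sq_norm, Complex.normSq_apply]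
    simp [sq]
  exact (sq_eq_sq₀ (norm_nonneg _) (norm_nonneg _)).1 h

theorem axis_planeCLM {I : ℍ[ℝ]} (hI : I ^ 2 = -1) {z : ℂ} (hz : z.im ≠ 0) :
    axis (planeCLM I z) = I ∨ axis (planeCLM I z) = -I := by
  rw [axis, im_planeCLM hI, norm_smul, norm_of_sq_eq_neg_one hI, mul_one, Real.norm_eq_abs,
    smul_smul]
  rcases abs_choice z.im with h | h
  · left; rw [h, inv_mul_cancel₀ hz, one_smul]
  · right; rw [h, inv_neg, neg_mul, inv_mul_cancel₀ hz, neg_one_smul]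

theorem planeCLM_circleMap {I : ℍ[ℝ]} (hI : I ^ 2 = -1) (R θ : ℝ) :
    planeCLM I (circleMap 0 R θ) = R • NormedSpace.exp (θ • I) := by
  have hre : (θ • I).re = 0 := by simp [re_of_sq_eq_neg_one hI]
  have hexp : NormedSpace.exp (θ • I) = Real.cos θ • (1 : ℍ[ℝ]) + Real.sin θ • I := by
    rw [Quaternion.exp_of_re_eq_zero _ hre, norm_smul, norm_of_sq_eq_neg_one hI, mul_one,
      Real.norm_eq_abs, Real.cos_abs, smul_smul]
    congr 1
    · rw [← Quaternion.coe_one, Quaternion.smul_coe, mul_one]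
    · congr 1
      -- The quotient `sin ‖q‖ / ‖q‖` in the exponential formula degenerates at `θ = 0`.
      rcases eq_or_ne θ 0 with rfl | hθ
      · simp
      · rcases abs_choice θ with h | h <;> rw [h] <;> [skip; rw [Real.sin_neg, neg_div_neg_eq]] <;>
          field_simp
  rw [hexp, planeCLM_apply, circleMap_zero, Complex.exp_mul_I]
  simp [smul_smul, Complex.cos_ofReal_re, Complex.sin_ofReal_re]

theorem laplacian_comp_planeCLM {u : ℍ[ℝ] → ℝ} {I : ℍ[ℝ]} {z : ℂ}
    (h : ContDiffAt ℝ 2 u (planeCLM I z)) :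
    Laplacian.laplacian (u ∘ planeCLM I) z =
      fderiv ℝ (fderiv ℝ u) (planeCLM I z) 1 1 + fderiv ℝ (fderiv ℝ u) (planeCLM I z) I I := by
  have h1 : fderiv ℝ (u ∘ planeCLM I) =ᶠ[𝓝 z]
      fun y => (fderiv ℝ u (planeCLM I y)).comp (planeCLM I) := by
    filter_upwards [(planeCLM I).continuous.continuousAt.eventually (h.eventually (by simp))]
      with y hy
    rw [fderiv_comp y (hy.differentiableAt (by simp)) (planeCLM I).differentiableAt,
      ContinuousLinearMap.fderiv]
  have hD : DifferentiableAt ℝ (fderiv ℝ u) (planeCLM I z) :=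
    (h.fderiv_right (m := 1) (by norm_num)).differentiableAt (by simp)
  have h2 : HasFDerivAt (fun y => fderiv ℝ u (planeCLM I y))
      ((fderiv ℝ (fderiv ℝ u) (planeCLM I z)).comp (planeCLM I)) z :=
    HasFDerivAt.comp (F := ℍ[ℝ]) (G := ℍ[ℝ] →L[ℝ] ℝ) (g := fderiv ℝ u) z hD.hasFDerivAt
      (planeCLM I).hasFDerivAt
  have h3 := h2.clm_comp (hasFDerivAt_const (planeCLM I) z)
  have e1 : planeCLM I 1 = 1 := by simp [planeCLM_apply]
  have e2 : planeCLM I Complex.I = I := by simp [planeCLM_apply]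
  rw [InnerProductSpace.laplacian_eq_iteratedFDeriv_complexPlane]
  simp [iteratedFDeriv_two_apply, h1.fderiv_eq, h3.fderiv, e1, e2]

/-! ### Harmonicity on the planes `ℂ_I` and the Poisson formula -/

theorem harmonicContOnCl_comp_planeCLM {R : ℝ} {u : ℍ[ℝ] → ℝ}
    (hrot : RotationallyInvariantOn u (Metric.closedBall 0 R))
    (hC2 : ContDiffOn ℝ 2 u (Metric.closedBall 0 R))
    (hΔ : ∀ q ∈ Metric.ball (0 : ℍ[ℝ]) R, q.im ≠ 0 →
      laplacePrime (fun p => (u p : ℍ[ℝ])) q = 0) {I : ℍ[ℝ]} (hI : I ^ 2 = -1) :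
    InnerProductSpace.HarmonicContOnCl (u ∘ planeCLM I) (Metric.ball 0 R) := by
  have hmem : ∀ {z : ℂ}, z ∈ Metric.ball (0 : ℂ) R → planeCLM I z ∈ Metric.ball (0 : ℍ[ℝ]) R :=
    fun hz => by
      rw [mem_ball_zero_iff, norm_planeCLM hI]
      exact mem_ball_zero_iff.1 hz
  have hcd : ∀ {q}, q ∈ Metric.ball (0 : ℍ[ℝ]) R → ContDiffAt ℝ 2 u q := fun hq =>
    hC2.contDiffAt (mem_of_superset (Metric.isOpen_ball.mem_nhds hq) Metric.ball_subset_closedBall)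
  have hoff : ∀ z ∈ Metric.ball (0 : ℂ) R, z.im ≠ 0 →
      fderiv ℝ (fderiv ℝ u) (planeCLM I z) 1 1 +
        fderiv ℝ (fderiv ℝ u) (planeCLM I z) I I = 0 := fun z hz hz0 => by
    have him : (planeCLM I z).im ≠ 0 := by
      rw [im_planeCLM hI]
      exact smul_ne_zero hz0 (ne_zero_of_sq_eq_neg_one hI)
    have h0 := hΔ _ (hmem hz) him
    -- Equality near the point, not just at it, is needed because `Δ_*` differentiates.
    have hev : rotAverage (fun p => (u p : ℍ[ℝ])) =ᶠ[𝓝 (planeCLM I z)]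
        fun p => (u p : ℍ[ℝ]) := by
      filter_upwards [Metric.isOpen_ball.mem_nhds (hmem hz)] with p hp
      exact rotAverage_of_rotationallyInvariantOn hrot (Metric.ball_subset_closedBall hp)
    rw [laplacePrime, laplaceStar_congr hev, laplaceStar_coe (hcd (hmem hz)) him,
      ← Quaternion.coe_zero, Quaternion.coe_inj] at h0
    -- The sign of the axis is harmless: the second derivative is quadratic in it.
    rcases axis_planeCLM hI hz0 with h | h <;> simpa [h] using h0
  have hall : ∀ z ∈ Metric.ball (0 : ℂ) R,
      fderiv ℝ (fderiv ℝ u) (planeCLM I z) 1 1 +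
        fderiv ℝ (fderiv ℝ u) (planeCLM I z) I I = 0 := fun z hz => by
    rcases ne_or_eq z.im 0 with hz0 | hz0
    · exact hoff z hz hz0
    have hcont : ContinuousAt (fun y : ℂ => fderiv ℝ (fderiv ℝ u) (planeCLM I y) 1 1 +
        fderiv ℝ (fderiv ℝ u) (planeCLM I y) I I) z := by
      have hc : ContinuousAt (fderiv ℝ (fderiv ℝ u)) (planeCLM I z) :=
        (((hcd (hmem hz)).fderiv_right (m := 1) (by norm_num)).fderiv_right
          (m := 0) (by norm_num)).continuousAt
      have hc' : ContinuousAt (fun y : ℂ => fderiv ℝ (fderiv ℝ u) (planeCLM I y)) z :=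
        ContinuousAt.comp hc (planeCLM I).continuous.continuousAt
      exact ((hc'.clm_apply continuousAt_const).clm_apply continuousAt_const).add
        ((hc'.clm_apply continuousAt_const).clm_apply continuousAt_const)
    -- A real point `z` is approached vertically, through the non-real points `z + t i` with `t ≠
    -- 0`.
    have hline : Tendsto (fun t : ℝ => z + t * Complex.I) (𝓝[≠] 0) (𝓝 z) := by
      have : Continuous fun t : ℝ => z + t * Complex.I := by fun_prop
      simpa using (this.tendsto 0).mono_left nhdsWithin_le_nhds
    refine tendsto_nhds_unique (hcont.tendsto.comp hline) (tendsto_const_nhds.congr' ?_)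
    filter_upwards [hline.eventually (Metric.isOpen_ball.mem_nhds hz), self_mem_nhdsWithin]
      with t ht ht0
    refine (hoff _ ht ?_).symm
    simpa [hz0] using ht0
  refine InnerProductSpace.HarmonicContOnCl.mk_ball (fun z hz => ⟨?_, ?_⟩) ?_
  · exact (hcd (hmem hz)).comp z (planeCLM I).contDiff.contDiffAt
  · filter_upwards [Metric.isOpen_ball.mem_nhds hz] with y hy
    exact (laplacian_comp_planeCLM (hcd (hmem hy))).trans (hall y hy)
  · refine hC2.continuousOn.comp (planeCLM I).continuous.continuousOn fun z hz => ?_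
    rw [mem_closedBall_zero_iff, norm_planeCLM hI]
    exact mem_closedBall_zero_iff.1 hz

/-- `planeCLM I` is a linear isometry onto its image, so the kernel is the Poisson kernel of the
disc in `ℂ`. -/
theorem integral_poisson_planeCLM {R : ℝ} {u : ℍ[ℝ] → ℝ} {I : ℍ[ℝ]} (hI : I ^ 2 = -1)
    (h : InnerProductSpace.HarmonicContOnCl (u ∘ planeCLM I) (Metric.ball 0 R))
    {a : ℝ} (ha : |a| < R) :
    ∫ θ in (0 : ℝ)..(2 * Real.pi),
        (R ^ 2 - a ^ 2) / ‖R • NormedSpace.exp (θ • I) - (a : ℍ[ℝ])‖ ^ 2 *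
          u (R • NormedSpace.exp (θ • I)) = 2 * Real.pi * u (a : ℍ[ℝ]) := by
  have hacoe : planeCLM I (a : ℂ) = (a : ℍ[ℝ]) := by
    rw [planeCLM_apply, Complex.ofReal_re, Complex.ofReal_im, zero_smul, add_zero,
      ← Quaternion.coe_one, Quaternion.smul_coe, mul_one]
  have hmem : (a : ℂ) ∈ Metric.ball (0 : ℂ) R := by
    rwa [mem_ball_zero_iff, Complex.norm_real, Real.norm_eq_abs]
  have key := h.circleAverage_poissonKernel_smul hmem
  rw [Real.circleAverage_def, Function.comp_apply, hacoe] at key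
  rw [← key, smul_eq_mul, mul_inv_cancel_left₀ (by positivity)]
  refine intervalIntegral.integral_congr fun θ _ => ?_
  have hnorm : ‖circleMap 0 R θ‖ ^ 2 = R ^ 2 := by simp
  simp only [Pi.smul_apply', Function.comp_apply, smul_eq_mul, poissonKernel_def, sub_zero]
  rw [hnorm, ← planeCLM_circleMap hI, ← hacoe, ← map_sub, norm_planeCLM hI, Complex.norm_real,
    Real.norm_eq_abs, sq_abs]

end

end SliceQuat

theorem proposition7 (μ : MeasureTheory.Measure SliceQuat.ImUnit)
    [MeasureTheory.IsProbabilityMeasure μ]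
    (R : ℝ) (u : ℍ[ℝ] → ℝ)
    (hrot : SliceQuat.RotationallyInvariantOn u (Metric.closedBall 0 R))
    (hC2 : ContDiffOn ℝ 2 u (Metric.closedBall 0 R))
    (hΔ : ∀ q ∈ Metric.ball (0 : ℍ[ℝ]) R, q.im ≠ 0 →
      SliceQuat.laplacePrime (fun p => (u p : ℍ[ℝ])) q = 0)
    (a : ℝ) (ha : |a| < R) :
    u (a : ℍ[ℝ]) = 1 / (2 * Real.pi) *
      ∫ I : SliceQuat.ImUnit, (∫ θ in (0 : ℝ)..(2 * Real.pi),
        (R ^ 2 - a ^ 2) / ‖R • NormedSpace.exp (θ • (I : ℍ[ℝ])) - (a : ℍ[ℝ])‖ ^ 2 *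
          u (R • NormedSpace.exp (θ • (I : ℍ[ℝ])))) ∂μ := by
  have h : ∀ I : SliceQuat.ImUnit, _ := fun I =>
    SliceQuat.integral_poisson_planeCLM I.2
      (SliceQuat.harmonicContOnCl_comp_planeCLM hrot hC2 hΔ I.2) ha
  simp only [h, MeasureTheory.integral_const, MeasureTheory.probReal_univ, one_smul]
  field_simp
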